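/- Let $G$ be a finite non-abelian $2$-group of exponent $4$. The reduced power graph $P^*(G)$ is the simple graph whose vertices are the non-identity elements of $G$, two distinct vertices $u,v$ being adjacent if and only if one of them is a positive power of the other. Suppose that $P^*(G)$ is claw-free, that is, it has no induced subgraph isomorphic to the complete bipartite graph $K_{1,3}$. Then there exist an abelian normal subgroup $N$ of $G$ and an element $x\in G$ such that $G=N\langle x\rangle$, $|x|\leq 4$, and either $N$ is an elementary abelian $2$-group (possibly trivial) or $N$ is isomorphic to a subgroup of $C_4\times C_4$. -/

import Mathlib

open scoped Pointwise

/-- The undirected power graph of a group `G`: two distinct elements are adjacent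
iff one of them is a positive power of the other. -/
def powerGraph (G : Type*) [Group G] : SimpleGraph G where
  Adj u v := u ≠ v ∧ ((∃ i : ℕ, 0 < i ∧ u = v ^ i) ∨ (∃ j : ℕ, 0 < j ∧ v = u ^ j))
  symm := ⟨fun _ _ h => ⟨h.1.symm, h.2.symm⟩⟩
  loopless := ⟨fun _ h => h.1 rfl⟩

/-- The reduced power graph `P*(G)`: the subgraph of the power graph induced by the
non-identity elements. -/
def reducedPowerGraph (G : Type*) [Group G] : SimpleGraph {g : G | g ≠ 1} :=
  (powerGraph G).induce {g : G | g ≠ 1}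

/-- A graph is claw-free if it has no induced subgraph isomorphic to the complete bipartite
graph `K_{1,3}`. -/
def IsClawFree {V : Type*} (Γ : SimpleGraph V) : Prop :=
  ¬ (completeBipartiteGraph (Fin 1) (Fin 3)).IsIndContained Γ

/-! If three elements of order 4 share a square and no two are equal or inverse, that square and the
three roots form a claw. So the square roots of a nontrivial element fill at most two pairs `{a,
a⁻¹}` (`fewSquareRoots_of_isClawFree`), and only this is used afterwards.

If `x` has order 4 and commutes with an involution `t ≠ x²`, the roots of `x²` are exactly `x * w`
with `w` in `{1, x², t, x² t}`. Hence the involutions of the centralizer C(x) lie in this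
four-group, and C(x) is abelian (`commute_of_commute`). The same bound shows that an abelian
subgroup has exponent at most 2 or embeds in C₄ × C₄, so it is enough to write G = N⟨g⟩ with N
abelian and normal.

If some `x² ≠ 1` is central, the conjugates of `x` are roots of `x²` and commute with `x`, so C(x)
is normal of index at most 4. It serves as N, except when G/C(x) is a four-group; then N is the
centralizer of two commuting involutions (`cocyclic_of_central_square`).

Otherwise there is a central involution `v` that is not a square, and an involution `z` with
conjugates `z` and `z v`. N is then C(z), if that has exponent 2, or else the set of solutions of
`m² = 1` in C(z) (`cocyclic_of_no_central_square`). -/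

/-- Among any three square roots of a nontrivial element, two are equal or mutually inverse. -/
def FewSquareRoots (G : Type*) [Group G] : Prop :=
  ∀ a b c : G, a ^ 2 = b ^ 2 → a ^ 2 = c ^ 2 → a ^ 2 ≠ 1 →
    a = b ∨ a = b⁻¹ ∨ a = c ∨ a = c⁻¹ ∨ b = c ∨ b = c⁻¹

/-- The set `{1, z, t, z * t}`; a Klein four-group when `z`, `t` are commuting involutions. -/
def fourSet {G : Type*} [Group G] (z t : G) : Set G := {w | w = 1 ∨ w = z ∨ w = t ∨ w = z * t}

section

variable {G : Type*} [Group G]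

/-! ### From claws to square roots -/

theorem inv_eq_pow_three (h4 : ∀ g : G, g ^ 4 = 1) (g : G) : g⁻¹ = g ^ 3 :=
  inv_eq_of_mul_eq_one_left (by rw [← pow_succ, h4])

theorem inv_eq_mul_sq (h4 : ∀ g : G, g ^ 4 = 1) (g : G) : g⁻¹ = g * g ^ 2 := by
  rw [inv_eq_pow_three h4, ← pow_succ']

theorem sq_sq_eq_one (h4 : ∀ g : G, g ^ 4 = 1) (g : G) : (g ^ 2) ^ 2 = 1 := by
  rw [← pow_mul, h4]

theorem not_adj_of_sq_eq (h4 : ∀ g : G, g ^ 4 = 1) {a b : G} (hab : a ^ 2 = b ^ 2)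
    (ha : a ^ 2 ≠ 1) (h1 : a ≠ b) (h2 : a ≠ b⁻¹) : ¬ (powerGraph G).Adj a b := by
  have key : ∀ {a b : G}, a ^ 2 = b ^ 2 → a ^ 2 ≠ 1 → a ≠ b → a ≠ b⁻¹ →
      ∀ i : ℕ, a ≠ b ^ i := by
    intro a b hab ha h1 h2 i hi
    rw [← Nat.mod_add_div i 4, pow_add, pow_mul, h4, one_pow, mul_one] at hi
    have h : i % 4 < 4 := Nat.mod_lt _ (by norm_num)
    interval_cases i % 4
    · exact ha (by rw [hi]; simp)
    · exact h1 (by simpa using hi)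
    · exact ha (by rw [hi, sq_sq_eq_one h4])
    · exact h2 (by rw [inv_eq_pow_three h4, hi])
  rintro ⟨-, ⟨i, -, hi⟩ | ⟨i, -, hi⟩⟩
  · exact key hab ha h1 h2 i hi
  · exact key hab.symm (hab ▸ ha) h1.symm (fun h => h2 (by rw [h, inv_inv])) i hi

theorem fewSquareRoots_of_isClawFree (h4 : ∀ g : G, g ^ 4 = 1)
    (hclaw : IsClawFree (reducedPowerGraph G)) : FewSquareRoots G := by
  intro a b c hab hac ha
  by_contra! hcon
  obtain ⟨h1, h2, h3, h5, h6, h7⟩ := hcon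
  have hb : b ^ 2 ≠ 1 := hab ▸ ha
  have hc : c ^ 2 ≠ 1 := hac ▸ ha
  have ne1 : ∀ {g : G}, g ^ 2 ≠ 1 → g ≠ 1 := fun h e => h (by rw [e, one_pow])
  have nesq : ∀ {g : G}, g ^ 2 ≠ 1 → g ^ 2 ≠ g := fun h e => by
    rw [sq, mul_eq_left] at e
    exact ne1 h e
  have hadj : ∀ {g : G}, a ^ 2 = g ^ 2 → (powerGraph G).Adj (a ^ 2) g := fun {g} e =>
    ⟨e ▸ nesq (e ▸ ha), Or.inl ⟨2, by norm_num, e⟩⟩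
  have nab := not_adj_of_sq_eq h4 hab ha h1 h2
  have nac := not_adj_of_sq_eq h4 hac ha h3 h5
  have nbc := not_adj_of_sq_eq h4 (hab.symm.trans hac) hb h6 h7
  -- The three leaves of the claw; its centre is `a ^ 2`.
  let r : Fin 3 → {g : G | g ≠ 1} := ![⟨a, ne1 ha⟩, ⟨b, ne1 hb⟩, ⟨c, ne1 hc⟩]
  have hr2 : ∀ i, a ^ 2 = (r i : G) ^ 2 := by
    intro i; fin_cases i
    · rfl
    · exact hab
    · exact hac
  have hrr : ∀ i j, ¬ (powerGraph G).Adj (r i : G) (r j) := by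
    intro i j; fin_cases i <;> fin_cases j
    · exact fun h => h.1 rfl
    · exact nab
    · exact nac
    · exact fun h => nab h.symm
    · exact fun h => h.1 rfl
    · exact nbc
    · exact fun h => nac h.symm
    · exact fun h => nbc h.symm
    · exact fun h => h.1 rfl
  have hrinj : ∀ i j, r i = r j → i = j := by
    intro i j hij
    replace hij := congrArg Subtype.val hij
    fin_cases i <;> fin_cases j <;> first | rfl | (exfalso; revert hij)
    · exact h1
    · exact h3
    · exact h1.symm
    · exact h6
    · exact h3.symm
    · exact h6.symm
  refine hclaw ⟨⟨⟨Sum.elim (fun _ => ⟨a ^ 2, ha⟩) r, ?_⟩, ?_⟩⟩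
  · rintro (i | i) (j | j) hij
    · rw [Subsingleton.elim i j]
    · exact absurd (congrArg Subtype.val hij) (hadj (hr2 j)).1
    · exact absurd (congrArg Subtype.val hij).symm (hadj (hr2 i)).1
    · rw [hrinj i j hij]
  · rintro (i | i) (j | j)
    · exact iff_of_false (fun h => h.1 rfl) (by simp)
    · exact iff_of_true (hadj (hr2 j)) (by simp)
    · exact iff_of_true (hadj (hr2 i)).symm (by simp)
    · exact iff_of_false (hrr i j) (by simp)

/-! ### Conjugation identities, and centralizers of elements of order four -/

theorem SemiconjBy.mul_sq {g x y : G} (h : SemiconjBy g x y) :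
    (x * g) ^ 2 = x * y * g ^ 2 := by
  rw [sq, sq, mul_assoc, ← mul_assoc g x g, h.eq]
  simp only [mul_assoc]

theorem SemiconjBy.conj_self (g x : G) : SemiconjBy g x (g * x * g⁻¹) := by
  simp [SemiconjBy]

theorem SemiconjBy.eq_of {g x y y' : G} (h : SemiconjBy g x y) (h' : SemiconjBy g x y') : y = y' :=
  mul_right_cancel (h.eq.symm.trans h'.eq)

theorem fourSet.sq_eq_one {z t w : G} (hw : w ∈ fourSet z t) (hz : z ^ 2 = 1) (ht : t ^ 2 = 1)
    (hzt : Commute z t) : w ^ 2 = 1 := by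
  rcases hw with rfl | rfl | rfl | rfl
  · simp
  · exact hz
  · exact ht
  · rw [hzt.mul_pow, hz, ht, one_mul]

theorem fourSet.commute {z t w g : G} (hw : w ∈ fourSet z t) (hz : Commute g z) (ht : Commute g t) :
    Commute g w := by
  rcases hw with rfl | rfl | rfl | rfl
  · exact Commute.one_right g
  · exact hz
  · exact ht
  · exact hz.mul_right ht

/-- `x` and `x * t` are roots of `x ^ 2`, neither equal nor inverse, so every root is one of them or
an inverse; moreover `x⁻¹ = x * x ^ 2` and `(x * t)⁻¹ = x * (x ^ 2 * t)`. -/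
theorem sqrt_mem (h4 : ∀ g : G, g ^ 4 = 1) (hR : FewSquareRoots G) {x t y : G} (hx : x ^ 2 ≠ 1)
    (hxt : Commute x t) (ht : t ^ 2 = 1) (ht1 : t ≠ 1) (htx : t ≠ x ^ 2) (hy : y ^ 2 = x ^ 2) :
    ∃ w ∈ fourSet (x ^ 2) t, y = x * w := by
  have hti : t⁻¹ = t := inv_eq_of_mul_eq_one_left (by rw [← sq, ht])
  have hxti : (x * t)⁻¹ = x * (x ^ 2 * t) := by
    rw [mul_inv_rev, hti, ← hxt.inv_left.eq, inv_eq_mul_sq h4, mul_assoc]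
  rcases hR x (x * t) y (by rw [hxt.mul_pow, ht, mul_one]) hy.symm hx with h | h | h | h | h | h
  · exact absurd (mul_eq_left.mp h.symm) ht1
  · rw [hxti, eq_comm, mul_eq_left] at h
    exact absurd (by rw [mul_eq_one_iff_eq_inv.mp h, hti]) htx
  · exact ⟨1, Or.inl rfl, by rw [h, mul_one]⟩
  · exact ⟨x ^ 2, Or.inr (Or.inl rfl), by rw [← inv_eq_mul_sq h4, h, inv_inv]⟩
  · exact ⟨t, Or.inr (Or.inr (Or.inl rfl)), h.symm⟩
  · exact ⟨x ^ 2 * t, Or.inr (Or.inr (Or.inr rfl)), by rw [← hxti, h, inv_inv]⟩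

theorem involution_mem (h4 : ∀ g : G, g ^ 4 = 1) (hR : FewSquareRoots G) {x t s : G}
    (hx : x ^ 2 ≠ 1) (hxt : Commute x t) (ht : t ^ 2 = 1) (ht1 : t ≠ 1) (htx : t ≠ x ^ 2)
    (hxs : Commute x s) (hs : s ^ 2 = 1) : s ∈ fourSet (x ^ 2) t := by
  obtain ⟨w, hw, h⟩ := sqrt_mem h4 hR hx hxt ht ht1 htx (y := x * s)
    (by rw [hxs.mul_pow, hs, mul_one])
  rwa [mul_left_cancel h]

/-- The centralizer of an element of order four, when it contains a subgroup `C₄ × C₄`. -/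
theorem mem_of_commute_of_sq_ne (h4 : ∀ g : G, g ^ 4 = 1) (hR : FewSquareRoots G) {x y c : G}
    (hx : x ^ 2 ≠ 1) (hy : y ^ 2 ≠ 1) (hxy : Commute x y) (hne : y ^ 2 ≠ x ^ 2)
    (hc : Commute x c) :
    ∃ w ∈ fourSet (x ^ 2) (y ^ 2), c = w ∨ c = x * w ∨ c = y * w ∨ c = x * y * w := by
  have hs := sq_sq_eq_one h4
  have hxy2 : Commute x (y ^ 2) := hxy.pow_right 2
  have hyx2 : Commute y (x ^ 2) := hxy.symm.pow_right 2
  have hxxyy : (x * y) ^ 2 = x ^ 2 * y ^ 2 := hxy.mul_pow 2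
  -- `c ^ 2` is one of `1`, `x ^ 2`, `y ^ 2`, `x ^ 2 * y ^ 2`; in the last three cases `c` is a root
  -- of the square of `x`, `y` or `x * y`.
  rcases involution_mem h4 hR hx hxy2 (hs y) hy hne (hc.pow_right 2) (hs c) with h | h | h | h
  · exact ⟨c, involution_mem h4 hR hx hxy2 (hs y) hy hne hc h, Or.inl rfl⟩
  · obtain ⟨w, hw, e⟩ := sqrt_mem h4 hR hx hxy2 (hs y) hy hne h
    exact ⟨w, hw, Or.inr (Or.inl e)⟩
  · obtain ⟨w, hw, e⟩ := sqrt_mem h4 hR hy hyx2 (hs x) hx hne.symm h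
    refine ⟨w, ?_, Or.inr (Or.inr (Or.inl e))⟩
    have := (hxy.pow_pow 2 2).eq
    rcases hw with h | h | h | h
    · exact Or.inl h
    · exact Or.inr (Or.inr (Or.inl h))
    · exact Or.inr (Or.inl h)
    · exact Or.inr (Or.inr (Or.inr (h.trans this.symm)))
  · have hp : (x * y) ^ 2 ≠ 1 := by
      rw [hxxyy]
      intro e
      have := mul_eq_one_iff_eq_inv.mp e
      rw [inv_eq_mul_sq h4, hs y, mul_one] at this
      exact hne this.symm
    have hp2 : x ^ 2 ≠ (x * y) ^ 2 := by
      rw [hxxyy]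
      intro e
      exact hy (mul_eq_left.mp e.symm)
    obtain ⟨w, hw, e⟩ := sqrt_mem h4 hR hp ((Commute.refl x).pow_right 2 |>.mul_left hyx2) (hs x)
      hx hp2 (h.trans hxxyy.symm)
    refine ⟨w, ?_, Or.inr (Or.inr (Or.inr e))⟩
    have hc' := (hxy.pow_pow 2 2).eq
    rw [hxxyy] at hw
    rcases hw with h | h | h | h
    · exact Or.inl h
    · exact Or.inr (Or.inr (Or.inr h))
    · exact Or.inr (Or.inl h)
    · refine Or.inr (Or.inr (Or.inl ?_))
      rw [h, hc', mul_assoc, ← sq, hs, mul_one]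

/-- The centralizer of an element of order four, when all its elements of order four
have the same square. -/
theorem mem_of_commute_of_sq_eq (h4 : ∀ g : G, g ^ 4 = 1) (hR : FewSquareRoots G) {x t c : G}
    (hx : x ^ 2 ≠ 1) (hxt : Commute x t) (ht : t ^ 2 = 1) (ht1 : t ≠ 1) (htx : t ≠ x ^ 2)
    (hc : Commute x c) (hcx : c ^ 2 = 1 ∨ c ^ 2 = x ^ 2) :
    ∃ w ∈ fourSet (x ^ 2) t, c = w ∨ c = x * w := by
  rcases hcx with h | h
  · exact ⟨c, involution_mem h4 hR hx hxt ht ht1 htx hc h, Or.inl rfl⟩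
  · obtain ⟨w, hw, e⟩ := sqrt_mem h4 hR hx hxt ht ht1 htx h
    exact ⟨w, hw, Or.inr e⟩

/-- The centralizer of `x` is explicit: generated by `x`, `y` and squares, or by `x` and one more
involution, or by `x` alone. Each time the generators commute with all of it. -/
theorem commute_of_commute (h4 : ∀ g : G, g ^ 4 = 1) (hR : FewSquareRoots G) {x a b : G}
    (hx : x ^ 2 ≠ 1) (ha : Commute x a) (hb : Commute x b) : Commute a b := by
  by_cases hy : ∃ y, Commute x y ∧ y ^ 2 ≠ 1 ∧ y ^ 2 ≠ x ^ 2
  · obtain ⟨y, hxy, hy1, hyx⟩ := hy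
    have key : ∀ c, Commute x c → Commute c y := by
      intro c hc
      obtain ⟨w, hw, e⟩ := mem_of_commute_of_sq_ne h4 hR hx hy1 hxy hyx hc
      have hwy : Commute w y :=
        (fourSet.commute hw (hxy.symm.pow_right 2) ((Commute.refl y).pow_right 2)).symm
      rcases e with rfl | rfl | rfl | rfl
      · exact hwy
      · exact hxy.mul_left hwy
      · exact (Commute.refl y).mul_left hwy
      · exact (hxy.mul_left (Commute.refl y)).mul_left hwy
    obtain ⟨w, hw, e⟩ := mem_of_commute_of_sq_ne h4 hR hx hy1 hxy hyx ha
    have hwb : Commute w b :=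
      (fourSet.commute hw (hb.symm.pow_right 2) ((key b hb).pow_right 2)).symm
    rcases e with rfl | rfl | rfl | rfl
    · exact hwb
    · exact hb.mul_left hwb
    · exact (key b hb).symm.mul_left hwb
    · exact (hb.mul_left (key b hb).symm).mul_left hwb
  push Not at hy
  by_cases ht : ∃ t, Commute x t ∧ t ^ 2 = 1 ∧ t ≠ 1 ∧ t ≠ x ^ 2
  · obtain ⟨t, hxt, ht, ht1, htx⟩ := ht
    have key : ∀ c, Commute x c → Commute c t := by
      intro c hc
      obtain ⟨w, hw, e⟩ := mem_of_commute_of_sq_eq h4 hR hx hxt ht ht1 htx hc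
        (or_iff_not_imp_left.mpr (hy c hc))
      have hwt : Commute w t := (fourSet.commute hw (hxt.symm.pow_right 2) (Commute.refl t)).symm
      rcases e with rfl | rfl
      · exact hwt
      · exact hxt.mul_left hwt
    obtain ⟨w, hw, e⟩ := mem_of_commute_of_sq_eq h4 hR hx hxt ht ht1 htx ha
        (or_iff_not_imp_left.mpr (hy a ha))
    have hwb : Commute w b := (fourSet.commute hw (hb.symm.pow_right 2) (key b hb)).symm
    rcases e with rfl | rfl
    · exact hwb
    · exact hb.mul_left hwb
  push Not at ht
  have key : ∀ s, Commute x s → s ^ 2 = 1 → s = 1 ∨ s = x ^ 2 := fun s h1 h2 =>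
    or_iff_not_imp_left.mpr (ht s h1 h2)
  by_cases ha2 : a ^ 2 = 1
  · rcases key a ha ha2 with rfl | rfl
    · exact Commute.one_left b
    · exact hb.pow_left 2
  · have e := hy a ha ha2
    have hxa := key (x * a) ((Commute.refl x).mul_right ha)
      (by rw [ha.mul_pow, e, ← sq, sq_sq_eq_one h4])
    have : Commute (x * a) b := by
      rcases hxa with h | h
      · rw [h]; exact Commute.one_left b
      · rw [h]; exact hb.pow_left 2
    have h3 := hb.inv_left.mul_left this
    rwa [inv_mul_cancel_left] at h3

theorem commute_iff_of_commute (h4 : ∀ g : G, g ^ 4 = 1) (hR : FewSquareRoots G) {x a b : G}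
    (hx : x ^ 2 ≠ 1) (ha : a ^ 2 ≠ 1) (hxa : Commute x a) : Commute x b ↔ Commute a b :=
  ⟨fun h => commute_of_commute h4 hR hx hxa h, fun h => commute_of_commute h4 hR ha hxa.symm h⟩

end

/-! ### Embedding abelian groups in C₄ × C₄ -/

theorem hasEnoughRootsOfUnity_multiplicative_zmod (n : ℕ) [NeZero n] :
    HasEnoughRootsOfUnity (Multiplicative (ZMod n)) n where
  prim := ⟨Multiplicative.ofAdd 1, by
    convert IsPrimitiveRoot.orderOf (Multiplicative.ofAdd (1 : ZMod n))
    rw [orderOf_ofAdd_eq_addOrderOf, ZMod.addOrderOf_one]⟩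
  cyc := by
    have : IsCyclic (Multiplicative (ZMod n))ˣ :=
      isCyclic_of_surjective (toUnits (G := Multiplicative (ZMod n))) toUnits.surjective
    exact Subgroup.isCyclic _

theorem exists_monoidHom_zmod_four {N : Type*} [CommGroup N] [Finite N]
    (h4 : ∀ n : N, n ^ 4 = 1) (a : N) :
    ∃ φ : N →* Multiplicative (ZMod 4), φ a = 1 → a = 1 := by
  by_cases ha : a = 1
  · exact ⟨1, fun _ => ha⟩
  have := hasEnoughRootsOfUnity_multiplicative_zmod 4
  have : HasEnoughRootsOfUnity (Multiplicative (ZMod 4)) (Monoid.exponent N) :=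
    HasEnoughRootsOfUnity.of_dvd _ (Monoid.exponent_dvd_of_forall_pow_eq_one h4)
  obtain ⟨φ, hφ⟩ := CommGroup.exists_apply_ne_one_of_hasEnoughRootsOfUnity N
    (Multiplicative (ZMod 4)) ha
  exact ⟨(toUnits (G := Multiplicative (ZMod 4))).symm.toMonoidHom.comp φ,
    fun h => absurd ((MulEquiv.map_eq_one_iff toUnits.symm).mp h) hφ⟩

/-- An abelian group of exponent dividing four with at most three involutions embeds in
`C₄ × C₄`. -/
theorem exists_injective_zmod_four_prod {N : Type*} [CommGroup N] [Finite N]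
    (h4 : ∀ n : N, n ^ 4 = 1) (a b : N) (hab : ∀ s : N, s ^ 2 = 1 → s ∈ fourSet a b) :
    ∃ f : N →* Multiplicative (ZMod 4) × Multiplicative (ZMod 4), Function.Injective f := by
  classical
  obtain ⟨φ, hφ⟩ := exists_monoidHom_zmod_four h4 a
  -- `φ` detects `a`. If it kills `b`, then `ψ` must detect `b`; otherwise only `a * b` can still
  -- escape `φ`.
  obtain ⟨ψ, hψ⟩ := exists_monoidHom_zmod_four h4 (if φ b = 1 then b else a * b)
  have key : ∀ s : N, s ^ 2 = 1 → φ s = 1 → ψ s = 1 → s = 1 := by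
    intro s hs h1 h2
    rcases hab s hs with rfl | rfl | rfl | rfl
    · rfl
    · exact hφ h1
    · rw [if_pos h1] at hψ
      exact hψ h2
    · split_ifs at hψ with hb
      · rw [map_mul, hb, mul_one] at h1
        rw [hφ h1, one_mul] at h2 ⊢
        exact hψ h2
      · exact hψ h2
  refine ⟨φ.prod ψ, (injective_iff_map_eq_one _).mpr fun c hc => ?_⟩
  obtain ⟨h1, h2⟩ := Prod.ext_iff.mp hc
  replace h1 : φ c = 1 := h1
  replace h2 : ψ c = 1 := h2
  -- Injectivity on involutions suffices: it gives `c ^ 2 = 1`, and then `c = 1`.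
  exact key c (key (c ^ 2) (by rw [← pow_mul, h4]) (by rw [map_pow, h1, one_pow])
    (by rw [map_pow, h2, one_pow])) h1 h2

section

variable {G : Type*} [Group G]

/-! ### Reduction to an abelian normal subgroup with cyclic supplement -/

/-- `G` is the product of an abelian normal subgroup and a cyclic subgroup. -/
def HasAbelianNormalCocyclic (G : Type*) [Group G] : Prop :=
  ∃ (N : Subgroup G) (g : G), N.Normal ∧ (∀ a ∈ N, ∀ b ∈ N, Commute a b) ∧
    ∀ b : G, ∃ k : ℤ, b * g ^ k ∈ N

theorem subgroup_sq_eq_one_or_embeds [Finite G] (h4 : ∀ g : G, g ^ 4 = 1) (hR : FewSquareRoots G)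
    (N : Subgroup G) (hN : ∀ a ∈ N, ∀ b ∈ N, Commute a b) :
    (∀ n ∈ N, n ^ 2 = 1) ∨
      ∃ f : N →* Multiplicative (ZMod 4) × Multiplicative (ZMod 4), Function.Injective f := by
  refine or_iff_not_imp_left.mpr fun h => ?_
  push Not at h
  obtain ⟨x, hxN, hx⟩ := h
  let _ : CommGroup N := { mul_comm := fun a b => Subtype.ext (hN a a.2 b b.2) }
  have h4N : ∀ n : N, n ^ 4 = 1 := fun n => Subtype.ext (h4 n)
  by_cases ht : ∃ t ∈ N, t ^ 2 = 1 ∧ t ≠ 1 ∧ t ≠ x ^ 2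
  · obtain ⟨t, htN, ht2, ht1, htx⟩ := ht
    refine exists_injective_zmod_four_prod h4N ⟨x ^ 2, N.pow_mem hxN 2⟩ ⟨t, htN⟩ fun s hs => ?_
    have hs' := involution_mem h4 hR hx (hN x hxN t htN) ht2 ht1 htx (hN x hxN s s.2)
      (congrArg Subtype.val hs)
    rcases hs' with h | h | h | h
    · exact Or.inl (Subtype.ext h)
    · exact Or.inr (Or.inl (Subtype.ext h))
    · exact Or.inr (Or.inr (Or.inl (Subtype.ext h)))
    · exact Or.inr (Or.inr (Or.inr (Subtype.ext h)))
  · push Not at ht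
    refine exists_injective_zmod_four_prod h4N ⟨x ^ 2, N.pow_mem hxN 2⟩ 1 fun s hs => ?_
    by_cases h1 : s = 1
    · exact Or.inl h1
    · exact Or.inr (Or.inl (Subtype.ext (ht s s.2 (congrArg Subtype.val hs)
        fun h => h1 (Subtype.ext h))))

theorem HasAbelianNormalCocyclic.conclusion [Finite G] (h4 : ∀ g : G, g ^ 4 = 1)
    (hR : FewSquareRoots G) (h : HasAbelianNormalCocyclic G) :
    ∃ (N : Subgroup G) (x : G),
      N.Normal ∧ IsMulCommutative N ∧
      (N : Set G) * (Subgroup.zpowers x : Set G) = Set.univ ∧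
      orderOf x ≤ 4 ∧
      ((∀ n ∈ N, n ^ 2 = 1) ∨
        ∃ f : N →* Multiplicative (ZMod 4) × Multiplicative (ZMod 4),
          Function.Injective f) := by
  obtain ⟨N, g, hnorm, hcomm, hcov⟩ := h
  refine ⟨N, g, hnorm, ⟨⟨fun a b => Subtype.ext (hcomm a a.2 b b.2)⟩⟩, ?_,
    orderOf_le_of_pow_eq_one (by norm_num) (h4 g), subgroup_sq_eq_one_or_embeds h4 hR N hcomm⟩
  refine Set.eq_univ_of_forall fun b => ?_
  obtain ⟨k, hk⟩ := hcov b
  exact ⟨b * g ^ k, hk, g ^ (-k), ⟨-k, rfl⟩, by simp⟩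

theorem Subgroup.normal_of_forall_mem_or_mul_mem (N : Subgroup G) (x : G)
    (h : ∀ b, b ∈ N ∨ b * x ∈ N) : N.Normal := by
  by_cases hx : x ∈ N
  · have : N = ⊤ := N.eq_top_iff'.mpr fun b => (h b).elim id fun hb =>
      (N.mul_mem_cancel_right hx).mp hb
    rw [this]
    infer_instance
  · refine Subgroup.normal_of_index_eq_two (Subgroup.index_eq_two_iff.mpr ⟨x, fun b => ?_⟩)
    rcases h b with hb | hb
    · exact Or.inr ⟨hb, fun hbx => hx ((N.mul_mem_cancel_left hb).mp hbx)⟩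
    · exact Or.inl ⟨hb, fun hb' => hx ((N.mul_mem_cancel_left hb').mp hb)⟩

theorem hasAbelianNormalCocyclic_of_two_cosets (N : Subgroup G) (x : G)
    (hN : ∀ a ∈ N, ∀ b ∈ N, Commute a b) (h : ∀ b, b ∈ N ∨ b * x ∈ N) :
    HasAbelianNormalCocyclic G :=
  ⟨N, x, N.normal_of_forall_mem_or_mul_mem x h, hN, fun b => (h b).elim
    (fun hb => ⟨0, by simpa using hb⟩) fun hb => ⟨1, by simpa using hb⟩⟩

/-! ### Some nontrivial square is central -/

/-- Two square roots of the same nontrivial element commute. -/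
theorem commute_of_sq_eq_sq (hR : FewSquareRoots G) {x y : G}
    (hx : x ^ 2 ≠ 1) (hxy : y ^ 2 = x ^ 2) : Commute x y := by
  have hxc : SemiconjBy x y (x * y * x⁻¹) := SemiconjBy.conj_self x y
  have hc2 : (x * y * x⁻¹) ^ 2 = x ^ 2 := by
    rw [conj_pow, hxy]; group
  rcases hR x y _ hxy.symm hc2.symm hx with h | h | h | h | h | h
  · exact h ▸ Commute.refl x
  · exact h ▸ (Commute.refl y).inv_left
  · have : x * y = x * x := hxc.eq.trans (by rw [← h])
    exact mul_left_cancel this ▸ Commute.refl x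
  · have : x * y = x⁻¹ * x := hxc.eq.trans (congrArg (· * x) (inv_eq_iff_eq_inv.mpr h).symm)
    rw [inv_mul_cancel] at this
    exact eq_inv_of_mul_eq_one_right this ▸ (Commute.refl x).inv_right
  · exact hxc.eq.trans (by rw [← h])
  -- Here `x` inverts `y`, so `y * x` is a further root of `x ^ 2`, to be compared with `x` and `y`.
  · have hxy' : x * y = y⁻¹ * x := hxc.eq.trans (by rw [inv_eq_iff_eq_inv.mpr h])
    have hyx2 : (y * x) ^ 2 = x ^ 2 := by
      rw [sq, mul_assoc, ← mul_assoc x, hxy', mul_assoc, mul_inv_cancel_left, sq]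
    rcases hR x y (y * x) hxy.symm hyx2.symm hx with h | h | h | h | h | h
    · exact h ▸ Commute.refl x
    · exact h ▸ (Commute.refl y).inv_left
    · exact mul_eq_right.mp h.symm ▸ Commute.one_right x
    · have h' : y = x⁻¹ * x⁻¹ := eq_mul_inv_of_mul_eq (inv_eq_iff_eq_inv.mpr h).symm
      exact h' ▸ ((Commute.refl x).inv_right.mul_right (Commute.refl x).inv_right)
    · exact mul_eq_left.mp h.symm ▸ Commute.one_left y
    · have h' : x = y⁻¹ * y⁻¹ := eq_inv_mul_of_mul_eq (inv_eq_iff_eq_inv.mpr h).symm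
      exact h' ▸ ((Commute.refl y).inv_left.mul_left (Commute.refl y).inv_left)

theorem SemiconjBy.symm_of_commute_sq {g x y : G} (h : SemiconjBy g x y)
    (hg : Commute x (g ^ 2)) : SemiconjBy g y x := by
  have h1 : g * y * g = x * g * g := by
    rw [mul_assoc, ← h.eq, ← mul_assoc, ← sq, ← hg.eq, sq, mul_assoc]
  exact mul_right_cancel h1

theorem mem_centralizer_singleton' {x g : G} :
    g ∈ Subgroup.centralizer {x} ↔ Commute x g := by
  rw [Subgroup.mem_centralizer_singleton_iff]
  exact eq_comm

theorem conj_sq_eq {g x : G} (hz : ∀ g : G, Commute g (x ^ 2)) : (g * x * g⁻¹) ^ 2 = x ^ 2 := by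
  rw [conj_pow, (hz g).eq, mul_inv_cancel_right]

theorem commute_conj (hR : FewSquareRoots G) {x : G}
    (hx : x ^ 2 ≠ 1) (hz : ∀ g : G, Commute g (x ^ 2)) (g : G) : Commute x (g * x * g⁻¹) :=
  commute_of_sq_eq_sq hR hx (conj_sq_eq hz)

/-- A conjugate of `x` is a root of `x ^ 2`, so it commutes with `x` and has the same centralizer.
-/
theorem normal_centralizer (h4 : ∀ g : G, g ^ 4 = 1) (hR : FewSquareRoots G) {x : G}
    (hx : x ^ 2 ≠ 1) (hz : ∀ g : G, Commute g (x ^ 2)) :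
    (Subgroup.centralizer {x}).Normal := by
  refine ⟨fun a ha g => ?_⟩
  rw [mem_centralizer_singleton'] at ha ⊢
  have hy := conj_sq_eq (g := g) hz
  rw [commute_iff_of_commute h4 hR hx (hy ▸ hx) (commute_conj hR hx hz g)]
  exact (Commute.conj_iff g).mpr ha

theorem exists_finset_sqrt (hR : FewSquareRoots G) {x : G} (hx : x ^ 2 ≠ 1) :
    ∃ S : Finset G, S.card ≤ 4 ∧ ∀ y, y ^ 2 = x ^ 2 → y ∈ S := by
  classical
  by_cases hb : ∃ b, b ^ 2 = x ^ 2 ∧ x ≠ b ∧ x ≠ b⁻¹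
  · obtain ⟨b, hb, h1, h2⟩ := hb
    refine ⟨{x, x⁻¹, b, b⁻¹}, Finset.card_le_four, fun y hy => ?_⟩
    rcases hR x b y hb.symm hy.symm hx with h | h | h | h | h | h
    · exact absurd h h1
    · exact absurd h h2
    · simp [h]
    · simp [h]
    · simp [h]
    · simp [h]
  · push Not at hb
    refine ⟨{x, x⁻¹}, Finset.card_le_two.trans (by norm_num), fun y hy => ?_⟩
    by_cases h : x = y
    · simp [h]
    · simp [hb y hy h]

theorem conj_eq_iff_commute {a b x : G} :
    a * x * a⁻¹ = b * x * b⁻¹ ↔ Commute x (b⁻¹ * a) := by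
  constructor
  · intro h
    have : b⁻¹ * (a * x * a⁻¹) * a = b⁻¹ * (b * x * b⁻¹) * a := by rw [h]
    simp only [mul_assoc, inv_mul_cancel, mul_one, inv_mul_cancel_left] at this
    rw [commute_iff_eq, mul_assoc, this]
  · intro h
    have h1 : b * (x * (b⁻¹ * a)) * a⁻¹ = b * (b⁻¹ * a * x) * a⁻¹ := by rw [h.eq]
    simp only [mul_assoc, mul_inv_cancel_left, mul_inv_cancel, mul_one] at h1
    simp only [mul_assoc, h1]

/-- Conjugating `x` by `1, g, g², g³` gives four distinct roots of `x ^ 2`, hence all of them. Any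
`b` thus conjugates `x` as a power of `g` does. -/
theorem cocyclic_of_sq_not_commute (h4 : ∀ g : G, g ^ 4 = 1) (hR : FewSquareRoots G) {x g : G}
    (hx : x ^ 2 ≠ 1) (hz : ∀ g : G, Commute g (x ^ 2)) (hg : ¬ Commute x (g ^ 2)) :
    HasAbelianNormalCocyclic G := by
  classical
  have hnorm := normal_centralizer h4 hR hx hz
  refine ⟨Subgroup.centralizer {x}, g, hnorm, fun a ha b hb => commute_of_commute h4 hR hx
    (mem_centralizer_singleton'.mp ha) (mem_centralizer_singleton'.mp hb), fun b => ?_⟩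
  have hg1 : ¬ Commute x g := fun h => hg (h.pow_right 2)
  have hg3 : ¬ Commute x (g ^ 3) := fun h => hg1 (by
    rw [← inv_eq_pow_three h4] at h
    exact Commute.inv_right_iff.mp h)
  let p : Fin 4 → G := fun i => g ^ (i : ℕ) * x * (g ^ (i : ℕ))⁻¹
  have hp : Function.Injective p := by
    have key : ∀ i j : Fin 4, i < j → p i ≠ p j := by
      intro i j hij h
      have h1 := conj_eq_iff_commute.mp h.symm
      have h2 : (g ^ (i : ℕ))⁻¹ * g ^ (j : ℕ) = g ^ ((j : ℕ) - i) := by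
        rw [inv_mul_eq_iff_eq_mul, ← pow_add]
        congr 1
        omega
      rw [h2] at h1
      have h3 : (j : ℕ) - i = 1 ∨ (j : ℕ) - i = 2 ∨ (j : ℕ) - i = 3 := by omega
      rcases h3 with e | e | e <;> rw [e] at h1
      · exact hg1 (by simpa using h1)
      · exact hg h1
      · exact hg3 h1
    intro i j h
    by_contra hne
    rcases lt_or_gt_of_ne hne with h' | h'
    · exact key i j h' h
    · exact key j i h' h.symm
  obtain ⟨S, hS4, hS⟩ := exists_finset_sqrt hR hx
  have himg : Finset.univ.image p = S := by
    refine Finset.eq_of_subset_of_card_le (fun y hy => ?_) ?_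
    · obtain ⟨i, -, rfl⟩ := Finset.mem_image.mp hy
      exact hS _ (conj_sq_eq hz)
    · rw [Finset.card_image_of_injective _ hp]
      simpa using hS4
  have hb : b * x * b⁻¹ ∈ Finset.univ.image p := himg ▸ hS _ (conj_sq_eq hz)
  obtain ⟨i, -, hi⟩ := Finset.mem_image.mp hb
  refine ⟨-(i : ℕ), ?_⟩
  rw [hnorm.mem_comm_iff, mem_centralizer_singleton', zpow_neg, zpow_natCast]
  exact conj_eq_iff_commute.mp hi.symm

/-- The case of a subgroup `C₄ × C₄` with a central square. -/
theorem cocyclic_of_two_squares (h4 : ∀ g : G, g ^ 4 = 1) (hR : FewSquareRoots G) {x y : G}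
    (hx : x ^ 2 ≠ 1) (hsq : ∀ g : G, Commute x (g ^ 2))
    (hxy : Commute x y) (hy : y ^ 2 ≠ 1) (hyx : y ^ 2 ≠ x ^ 2) :
    HasAbelianNormalCocyclic G := by
  have hs := sq_sq_eq_one h4
  have hroot : ∀ s, Commute x s → s ^ 2 = 1 → s ≠ 1 → ∃ u, Commute x u ∧ u ^ 2 = s := by
    intro s hxs hs2 hs1
    rcases involution_mem h4 hR hx (hxy.pow_right 2) (hs y) hy hyx hxs hs2 with h | h | h | h
    · exact absurd h hs1
    · exact ⟨x, Commute.refl x, h.symm⟩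
    · exact ⟨y, hxy, h.symm⟩
    · exact ⟨x * y, (Commute.refl x).mul_right hxy, by rw [h, hxy.mul_pow]⟩
  -- If `g ^ 2 ≠ 1`, it has a root `u` commuting with `x`. Then `g` commutes with `u`, hence with
  -- `x`.
  have hinvol : ∀ g, ¬ Commute x g → g ^ 2 = 1 := by
    intro g hg
    by_contra h1
    obtain ⟨u, hxu, hu⟩ := hroot _ (hsq g) (hs g) h1
    exact hg ((commute_iff_of_commute h4 hR hx (hu ▸ h1) hxu).mpr
      (commute_of_sq_eq_sq hR (hu ▸ h1) hu.symm))
  -- Both `g` and `x * g` lie outside the centralizer, so both are involutions.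
  have hinv : ∀ g, ¬ Commute x g → SemiconjBy g x x⁻¹ := by
    intro g hg
    have h1 := hinvol g hg
    have h2 := hinvol (x * g) fun h => hg (by
      simpa using (Commute.refl x).inv_right.mul_right h)
    rw [sq] at h1 h2
    have h3 : g⁻¹ = g := inv_eq_of_mul_eq_one_left h1
    rw [← mul_assoc, mul_eq_one_iff_eq_inv, h3, mul_assoc] at h2
    exact eq_inv_mul_iff_mul_eq.mpr h2
  have hcomm : ∀ a b : G, Commute x a → Commute x b → Commute a b :=
    fun a b => commute_of_commute h4 hR hx
  by_cases hG : ∃ g, ¬ Commute x g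
  · obtain ⟨g, hg⟩ := hG
    refine hasAbelianNormalCocyclic_of_two_cosets (Subgroup.centralizer {x}) g ?_ fun b => ?_
    · exact fun a ha b hb => hcomm a b (mem_centralizer_singleton'.mp ha)
        (mem_centralizer_singleton'.mp hb)
    · refine or_iff_not_imp_left.mpr fun hb => ?_
      rw [mem_centralizer_singleton'] at hb ⊢
      have := (hinv b hb).inv_right.mul_left (hinv g hg)
      rw [inv_inv] at this
      exact Commute.symm this
  · push Not at hG
    exact hasAbelianNormalCocyclic_of_two_cosets ⊤ 1 (fun a _ b _ => hcomm a b (hG a) (hG b))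
      fun b => Or.inl (Subgroup.mem_top b)

/-- A group generated modulo the Klein four-group `{1, x², t, x² t}` by `x` and by two commuting
involutions, the first of which inverts `x`. -/
theorem cocyclic_of_commuting_involutions {x t g₁ g₂ : G}
    (hx : x ^ 2 ≠ 1) (hz : ∀ g : G, Commute g (x ^ 2))
    (hxt : Commute x t)
    (hA : ∀ c, Commute x c → ∃ w ∈ fourSet (x ^ 2) t, c = w ∨ c = x * w)
    (hconj : ∀ g, ∃ w ∈ fourSet (x ^ 2) t, SemiconjBy g x (x * w))
    (h₁ : SemiconjBy g₁ x (x * x ^ 2)) (h₂ : SemiconjBy g₂ x (x * t))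
    (h₁t : Commute g₁ t) (h₂t : Commute g₂ t) (h₁₂ : Commute g₁ g₂) :
    HasAbelianNormalCocyclic G := by
  have hxz : Commute x (x ^ 2) := hz x
  -- Elements of `fourSet g₁ g₂` realize all four possible conjugations of `x`.
  have hform : ∀ b, ∃ g ∈ fourSet g₁ g₂, ∃ c, Commute x c ∧ b = g * c := by
    intro b
    have key : ∀ g y, SemiconjBy g x y → SemiconjBy b x y → Commute x (g⁻¹ * b) := fun g y h h' =>
      (show Commute (g⁻¹ * b) x from SemiconjBy.mul_left h.inv_symm_left h').symm
    obtain ⟨w, hw, hb⟩ := hconj b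
    rcases hw with rfl | rfl | rfl | rfl
    · exact ⟨1, Or.inl rfl, b, Commute.symm (show SemiconjBy b x x by simpa using hb), by simp⟩
    · exact ⟨g₁, Or.inr (Or.inl rfl), _, key g₁ _ h₁ hb, by simp⟩
    · exact ⟨g₂, Or.inr (Or.inr (Or.inl rfl)), _, key g₂ _ h₂ hb, by simp⟩
    · refine ⟨g₁ * g₂, Or.inr (Or.inr (Or.inr rfl)), _, key (g₁ * g₂) _ ?_ hb, (mul_inv_cancel_left _ _).symm⟩
      rw [← mul_assoc]
      exact (h₁.mul_right h₁t).mul_left h₂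
  have hxg₁ : ¬ Commute x g₁ := fun h => by
    have := SemiconjBy.eq_of h₁ h.symm
    exact hx (mul_eq_left.mp this)
  have hw₁ : ∀ w ∈ fourSet (x ^ 2) t, Commute g₁ w := fun w hw => fourSet.commute hw (hz _) h₁t
  have hw₂ : ∀ w ∈ fourSet (x ^ 2) t, Commute g₂ w := fun w hw => fourSet.commute hw (hz _) h₂t
  have hmem : ∀ b, b ∈ Subgroup.centralizer {g₁, g₂} ↔ Commute g₁ b ∧ Commute g₂ b := by
    intro b
    simp [Subgroup.mem_centralizer_iff, commute_iff_eq]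
  have hg₁ : ∀ g ∈ fourSet g₁ g₂, Commute g₁ g :=
    fun g hg => fourSet.commute hg (Commute.refl _) h₁₂
  have hg₂ : ∀ g ∈ fourSet g₁ g₂, Commute g₂ g :=
    fun g hg => fourSet.commute hg h₁₂.symm (Commute.refl _)
  have hNform : ∀ b ∈ Subgroup.centralizer {g₁, g₂},
      ∃ g ∈ fourSet g₁ g₂, ∃ w ∈ fourSet (x ^ 2) t, b = g * w := by
    intro b hb
    obtain ⟨g, hg, c, hc, rfl⟩ := hform b
    obtain ⟨w, hw, rfl | rfl⟩ := hA c hc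
    · exact ⟨g, hg, c, hw, rfl⟩
    · exfalso
      have h1 := (hg₁ g hg).inv_right.mul_right ((hmem _).mp hb).1
      rw [inv_mul_cancel_left] at h1
      have h2 := h1.mul_right (hw₁ w hw).inv_right
      rw [mul_inv_cancel_right] at h2
      exact hxg₁ h2.symm
  refine hasAbelianNormalCocyclic_of_two_cosets (Subgroup.centralizer {g₁, g₂}) x ?_ fun b => ?_
  · intro a ha b hb
    obtain ⟨g, hg, w, hw, rfl⟩ := hNform a ha
    have h := (hmem b).mp hb
    refine Commute.mul_left (fourSet.commute hg h.1.symm h.2.symm).symm ?_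
    obtain ⟨g', hg', w', hw', rfl⟩ := hNform b hb
    refine Commute.mul_right (fourSet.commute hg' (hw₁ w hw).symm (hw₂ w hw).symm) ?_
    refine fourSet.commute hw' (hz w) ?_
    exact (fourSet.commute hw (hz t) (Commute.refl t)).symm
  · obtain ⟨g, hg, c, hc, rfl⟩ := hform b
    obtain ⟨w, hw, rfl | rfl⟩ := hA c hc
    · exact Or.inl ((hmem _).mpr ⟨(hg₁ g hg).mul_right (hw₁ _ hw),
        (hg₂ g hg).mul_right (hw₂ _ hw)⟩)
    · refine Or.inr ((hmem _).mpr ?_)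
      have e : g * (x * w) * x = g * (x ^ 2 * w) := by
        rw [mul_assoc, mul_assoc x, ← (fourSet.commute hw hxz hxt).eq, ← mul_assoc x, ← sq]
      rw [e]
      exact ⟨(hg₁ g hg).mul_right ((hz g₁).mul_right (hw₁ _ hw)),
        (hg₂ g hg).mul_right ((hz g₂).mul_right (hw₂ _ hw))⟩

/-- Multiplying `g₁` or `g₂` by `x` where necessary turns them into commuting involutions; the
remaining values of the squares would yield a root of `x ^ 2` not commuting with `x`. -/
theorem cocyclic_of_two_conjugations (h4 : ∀ g : G, g ^ 4 = 1) (hR : FewSquareRoots G)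
    {x t g₁ g₂ : G} (hx : x ^ 2 ≠ 1) (hz : ∀ g : G, Commute g (x ^ 2))
    (hsq : ∀ g : G, Commute x (g ^ 2)) (hNC : ∀ c, Commute x c → c ^ 2 = 1 ∨ c ^ 2 = x ^ 2)
    (hxt : Commute x t) (ht : t ^ 2 = 1) (ht1 : t ≠ 1) (htx : t ≠ x ^ 2)
    (h₁ : SemiconjBy g₁ x (x * x ^ 2)) (h₂ : SemiconjBy g₂ x (x * t)) :
    HasAbelianNormalCocyclic G := by
  have hs := sq_sq_eq_one h4
  have hzt : Commute (x ^ 2) t := hxt.pow_left 2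
  have hti : t⁻¹ = t := inv_eq_of_mul_eq_one_left (by rw [← sq, ht])
  have hA : ∀ c, Commute x c → ∃ w ∈ fourSet (x ^ 2) t, c = w ∨ c = x * w := fun c hc =>
    mem_of_commute_of_sq_eq h4 hR hx hxt ht ht1 htx hc (hNC c hc)
  have hconj : ∀ g, ∃ w ∈ fourSet (x ^ 2) t, SemiconjBy g x (x * w) := by
    intro g
    obtain ⟨w, hw, h⟩ := sqrt_mem h4 hR hx hxt ht ht1 htx (conj_sq_eq (g := g) hz)
    exact ⟨w, hw, h ▸ SemiconjBy.conj_self g x⟩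
  have hnot : ∀ {g w}, w ≠ 1 → SemiconjBy g x (x * w) → ¬ Commute x g := fun hw h h' =>
    hw (mul_eq_left.mp (SemiconjBy.eq_of h h'.symm))
  have hzt1 : x ^ 2 * t ≠ 1 := fun h => htx (by
    rw [← hti]; exact (mul_eq_one_iff_eq_inv.mp h).symm)
  have h₂t : Commute g₂ t := by
    have h' := h₂.inv_right.mul_right (h₂.symm_of_commute_sq (hsq g₂))
    rw [inv_mul_cancel_left] at h'
    rw [mul_inv_rev, inv_mul_cancel_right, hti] at h'
    exact h'
  have h₁t : Commute g₁ t := by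
    rw [← inv_eq_mul_sq h4] at h₁
    have h := h₂.inv_right.mul_left h₁
    have h' := h.inv_right.mul_right (h.symm_of_commute_sq (hsq _)).inv_right
    rw [inv_inv, inv_mul_cancel_left, hxt.eq, mul_inv_cancel_right] at h'
    have h'' := h₂t.inv_left.mul_left h'
    rwa [inv_mul_cancel_left] at h''
  -- squares of elements not commuting with `x`
  have hsqV : ∀ {g w}, w ≠ 1 → SemiconjBy g x (x * w) → Commute g t →
      g ^ 2 = 1 ∨ g ^ 2 = t ∨ g ^ 2 = x ^ 2 * t := by
    intro g w hw hg hgt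
    have hxg := hnot hw hg
    obtain ⟨v, hv, h | h⟩ := hA _ (hsq g)
    · rcases hv with rfl | rfl | rfl | rfl
      · exact Or.inl h
      · exact absurd (commute_of_sq_eq_sq hR hx h) hxg
      · exact Or.inr (Or.inl h)
      · exact Or.inr (Or.inr h)
    · have h5 : Commute g (x * v) := h ▸ (Commute.refl g).pow_right 2
      have h6 := h5.mul_right (fourSet.commute hv (hz g) hgt).inv_right
      rw [mul_inv_cancel_right] at h6
      exact absurd h6.symm hxg
  have hxmul : ∀ {g}, Commute x (x * g) → Commute x g := fun h => by
    simpa using (Commute.refl x).inv_right.mul_right h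
  have hx4 : x * (x * x ^ 2) = 1 := by rw [← inv_eq_mul_sq h4, mul_inv_cancel]
  have h₁sq : g₁ ^ 2 = 1 := by
    -- Otherwise `x * g₁` is a root of `g₁ ^ 2`, so `x` lies in the four-group of `g₁ ^ 2` and `x ^
    -- 2`, contradicting `x ^ 2 ≠ 1`.
    by_contra h1
    have h5 : (x * g₁) ^ 2 = g₁ ^ 2 := by rw [h₁.mul_sq, hx4, one_mul]
    have h6 : x ^ 2 ≠ g₁ ^ 2 := fun h =>
      hnot hx h₁ (commute_of_sq_eq_sq hR hx h.symm)
    obtain ⟨w, hw, h⟩ := sqrt_mem h4 hR h1 (hz g₁) (hs x) hx h6 h5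
    have hgw : Commute g₁ w := fourSet.commute hw ((Commute.refl _).pow_right 2) (hz g₁)
    rw [hgw.eq] at h
    rw [mul_right_cancel h] at hx
    exact hx (fourSet.sq_eq_one hw (hs _) (hs _) (hz _))
  have h₂' : ∃ g, SemiconjBy g x (x * t) ∧ Commute g t ∧ g ^ 2 = 1 := by
    have hmul := h₂.mul_sq
    rcases hsqV ht1 h₂ h₂t with h | h | h
    · exact ⟨g₂, h₂, h₂t, h⟩
    · rw [h, ← mul_assoc, mul_assoc (x * x), ← sq, ← sq, ht, mul_one] at hmul
      exact absurd (hxmul (commute_of_sq_eq_sq hR hx hmul)) (hnot ht1 h₂)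
    · refine ⟨x * g₂, ?_, hxt.mul_left h₂t, ?_⟩
      · exact SemiconjBy.mul_left ((Commute.refl x).mul_right hxt) h₂
      · rw [hmul, h, hzt.eq, ← mul_assoc x x t, mul_assoc (x * x), ← mul_assoc t t, ← sq t, ht,
          one_mul, ← sq, ← sq, hs]
  obtain ⟨k, hk, hkt, hk2⟩ := h₂'
  have h₃ : SemiconjBy (g₁ * k) x (x * (x ^ 2 * t)) := by
    rw [← mul_assoc]
    exact (h₁.mul_right h₁t).mul_left hk
  have hcomm : ∀ {a b : G}, a ^ 2 = 1 → b ^ 2 = 1 → (a * b) ^ 2 = 1 → Commute a b := by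
    intro a b ha hb hab
    have e : ∀ {c : G}, c ^ 2 = 1 → c⁻¹ = c := fun h =>
      inv_eq_of_mul_eq_one_left (by rw [← sq, h])
    have := e hab
    rw [mul_inv_rev, e ha, e hb] at this
    exact this.symm
  have h₃mul : (x * (g₁ * k)) ^ 2 = t * (g₁ * k) ^ 2 := by
    rw [h₃.mul_sq, ← mul_assoc x (x ^ 2), ← mul_assoc x, hx4, one_mul]
  rcases hsqV hzt1 h₃ (h₁t.mul_left hkt) with h | h | h
  · exact cocyclic_of_commuting_involutions hx hz hxt hA hconj h₁ hk h₁t hkt (hcomm h₁sq hk2 h)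
  · refine cocyclic_of_commuting_involutions (g₁ := x * g₁) hx hz hxt hA hconj
      (SemiconjBy.mul_left ((Commute.refl x).mul_right (hz x)) h₁) hk (hxt.mul_left h₁t) hkt
      (hcomm ?_ hk2 ?_)
    · rw [h₁.mul_sq, hx4, one_mul, h₁sq]
    · rw [mul_assoc, h₃mul, h, ← sq, ht]
  · rw [h, hzt.eq, ← mul_assoc t, ← sq, ht, one_mul] at h₃mul
    exact absurd (hxmul (commute_of_sq_eq_sq hR hx h₃mul)) (hnot hzt1 h₃)

theorem cocyclic_of_central_square (h4 : ∀ g : G, g ^ 4 = 1) (hR : FewSquareRoots G)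
    {x : G} (hx : x ^ 2 ≠ 1) (hz : ∀ g : G, Commute g (x ^ 2)) :
    HasAbelianNormalCocyclic G := by
  by_cases hsq : ∀ g : G, Commute x (g ^ 2)
  swap
  · push Not at hsq
    obtain ⟨g, hg⟩ := hsq
    exact cocyclic_of_sq_not_commute h4 hR hx hz hg
  by_cases hy : ∃ y, Commute x y ∧ y ^ 2 ≠ 1 ∧ y ^ 2 ≠ x ^ 2
  · obtain ⟨y, hxy, hy1, hyx⟩ := hy
    exact cocyclic_of_two_squares h4 hR hx hsq hxy hy1 hyx
  push Not at hy
  have hNC : ∀ c, Commute x c → c ^ 2 = 1 ∨ c ^ 2 = x ^ 2 :=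
    fun c hc => or_iff_not_imp_left.mpr (hy c hc)
  have hab : ∀ a ∈ Subgroup.centralizer {x}, ∀ b ∈ Subgroup.centralizer {x}, Commute a b :=
    fun a ha b hb => commute_of_commute h4 hR hx (mem_centralizer_singleton'.mp ha)
      (mem_centralizer_singleton'.mp hb)
  by_cases h1 : ∃ g, ∀ b, Commute x b ∨ Commute x (b * g)
  · obtain ⟨g, hg⟩ := h1
    exact hasAbelianNormalCocyclic_of_two_cosets (Subgroup.centralizer {x}) g hab
      fun b => (hg b).imp mem_centralizer_singleton'.mpr mem_centralizer_singleton'.mpr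
  push Not at h1
  -- The centralizer has index above 2: `g`, `h` and `h * g` all lie outside it.
  obtain ⟨g, hg, -⟩ := h1 1
  obtain ⟨h, hh, hhg⟩ := h1 g
  have hex : ∀ g, ∃ w, w ^ 2 = 1 ∧ Commute x w ∧ SemiconjBy g x (x * w) := by
    intro g
    have hc := commute_conj hR hx hz g
    refine ⟨x⁻¹ * (g * x * g⁻¹), ?_, (Commute.refl x).inv_right.mul_right hc, ?_⟩
    · rw [hc.inv_left.mul_pow, conj_sq_eq hz, inv_pow, inv_mul_cancel]
    · rw [mul_inv_cancel_left]
      exact SemiconjBy.conj_self g x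
  have hne : ∀ {g w}, ¬ Commute x g → SemiconjBy g x (x * w) → w ≠ 1 := by
    rintro g _ hg hw rfl
    rw [mul_one] at hw
    exact hg (Commute.symm hw)
  have hsame : ∀ {a b w}, SemiconjBy a x (x * w) → SemiconjBy b x (x * w) →
      Commute x (a * b) := by
    intro a b w ha hb
    exact Commute.symm (SemiconjBy.mul_left (ha.symm_of_commute_sq (hsq a)) hb)
  obtain ⟨t, ht, hxt, hct⟩ := hex h
  obtain ⟨w, hw, hxw, hcw⟩ := hex g
  have ht1 := hne hh hct
  have hw1 := hne (by simpa using hg) hcw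
  -- `h` and `g` multiply `x` by distinct involutions of one four-group, so one of `h`, `g`, `h * g`
  -- multiplies it by `x ^ 2`.
  by_cases htx : t = x ^ 2
  · refine cocyclic_of_two_conjugations h4 hR hx hz hsq hNC hxw hw hw1 ?_ (htx ▸ hct) hcw
    intro e
    subst htx
    rw [e] at hcw
    exact hhg (hsame hct hcw)
  have hxw' := involution_mem h4 hR hx hxt ht ht1 htx hxw hw
  rcases hxw' with e | e | e | e
  · exact absurd e hw1
  · exact cocyclic_of_two_conjugations h4 hR hx hz hsq hNC hxt ht ht1 htx (e ▸ hcw) hct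
  · exact absurd (hsame hct (e ▸ hcw)) hhg
  · have hti : t⁻¹ = t := inv_eq_of_mul_eq_one_left (by rw [← sq, ht])
    have hht : Commute h t := by
      have h' := hct.inv_right.mul_right (hct.symm_of_commute_sq (hsq h))
      rw [inv_mul_cancel_left, mul_inv_rev, inv_mul_cancel_right, hti] at h'
      exact h'
    refine cocyclic_of_two_conjugations (g₁ := h * g) h4 hR hx hz hsq hNC hxt ht ht1 htx ?_ hct
    have h5 := SemiconjBy.mul_left (hct.mul_right ((hz h).mul_right hht)) (e ▸ hcw)
    rw [(hxt.pow_left 2).eq, ← mul_assoc, mul_assoc x t t, ← sq t, ht, mul_one] at h5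
    exact h5

/-! ### No nontrivial square is central -/

/-- Commuting elements of order four have the same square when some central involution is not
a square. -/
theorem sq_eq_of_commute (h4 : ∀ g : G, g ^ 4 = 1) (hR : FewSquareRoots G) {v : G}
    (hv : ∀ g : G, Commute g v) (hv1 : v ≠ 1) (hv2 : v ^ 2 = 1) (hvsq : ∀ g : G, g ^ 2 ≠ v)
    {x c : G} (hx : x ^ 2 ≠ 1) (hc : Commute x c) : c ^ 2 = 1 ∨ c ^ 2 = x ^ 2 := by
  by_contra! h
  rcases involution_mem h4 hR hx (hc.pow_right 2) (sq_sq_eq_one h4 c) h.1 h.2 (hv x) hv2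
    with e | e | e | e
  · exact hv1 e
  · exact hvsq x e.symm
  · exact hvsq c e.symm
  · exact hvsq (x * c) (by rw [hc.mul_pow, e])

/-- The case of a square `x ^ 2` whose conjugates are `x ^ 2` and `x ^ 2 * v`, for a central
involution `v` that is not a square. -/
theorem cocyclic_of_almost_central_square (h4 : ∀ g : G, g ^ 4 = 1) (hR : FewSquareRoots G) {v : G}
    (hv : ∀ g : G, Commute g v) (hv1 : v ≠ 1) (hv2 : v ^ 2 = 1) (hvsq : ∀ g : G, g ^ 2 ≠ v)
    {x g : G} (hx : x ^ 2 ≠ 1)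
    (hconj : ∀ g : G, Commute g (x ^ 2) ∨ SemiconjBy g (x ^ 2) (x ^ 2 * v))
    (hg : SemiconjBy g (x ^ 2) (x ^ 2 * v)) :
    HasAbelianNormalCocyclic G := by
  have hs := sq_sq_eq_one h4
  obtain ⟨z, hz⟩ : ∃ z, z = x ^ 2 := ⟨_, rfl⟩
  obtain ⟨y, hy⟩ : ∃ y, y = g * x * g⁻¹ := ⟨_, rfl⟩
  have hz2 : z ^ 2 = 1 := hz ▸ hs x
  have hzz : z * z = 1 := by rw [← sq, hz2]
  have hvv : v * v = 1 := by rw [← sq, hv2]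
  have hvx : v ≠ x ^ 2 := (hvsq x).symm
  have hxz : Commute x z := hz ▸ (Commute.refl x).pow_right 2
  have hvz : Commute v z := (hv z).symm
  have hxx : ∀ w, x * (x * w) = z * w := fun w => by rw [← mul_assoc, ← sq, ← hz]
  have hgxy : SemiconjBy g x y := hy ▸ SemiconjBy.conj_self g x
  have hy2 : y ^ 2 = z * v := by
    have h1 := hgxy.pow_right 2
    rw [hz]
    exact SemiconjBy.eq_of h1 hg
  have hyz : Commute y z := by
    have h1 : Commute y (z * v) := hy2 ▸ (Commute.refl y).pow_right 2
    have h2 := h1.mul_right (hv y)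
    rwa [mul_assoc, hvv, mul_one] at h2
  rw [← hz] at hconj hg
  have hz1 : z ≠ 1 := hz ▸ hx
  have hzvne : z * v ≠ 1 := fun h => by
    rw [mul_eq_one_iff_eq_inv, inv_eq_of_mul_eq_one_left hvv] at h
    exact hvsq x (hz ▸ h)
  have hyne : y ^ 2 ≠ 1 := hy2 ▸ hzvne
  have hxy : ¬ Commute x y := fun h => by
    rcases sq_eq_of_commute h4 hR hv hv1 hv2 hvsq hx h with e | e
    · exact hyne e
    · rw [hy2, ← hz] at e
      exact hv1 (mul_eq_left.mp e)
  have hnc : ∀ {m w}, w ≠ 1 → SemiconjBy m x (x * w) → ¬ Commute x m := fun hw h h' =>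
    hw (mul_eq_left.mp (SemiconjBy.eq_of h h'.symm))
  have hxmul : ∀ {a b : G}, Commute a (a * b) → Commute a b := fun {a b} h => by
    simpa using (Commute.refl a).inv_right.mul_right h
  have hmul : ∀ {a b : G}, Commute b (a * b) → Commute b a := fun {a b} h => by
    simpa using h.mul_right (Commute.refl b).inv_right
  have hW : ∀ {m w}, Commute m z → w ∈ fourSet z v → Commute m w :=
    fun hm hw => fourSet.commute hw hm (hv _)
  have hconjx : ∀ m, Commute m z → ∃ w ∈ fourSet z v, SemiconjBy m x (x * w) := by
    intro m hm
    have h1 : (m * x * m⁻¹) ^ 2 = x ^ 2 := by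
      rw [conj_pow, ← hz, hm.eq, mul_inv_cancel_right]
    obtain ⟨w, hw, e⟩ := sqrt_mem h4 hR hx (hv x) hv2 hv1 hvx h1
    exact ⟨w, hz ▸ hw, e ▸ SemiconjBy.conj_self m x⟩
  have hconjy : ∀ m, Commute m z → ∃ w ∈ fourSet (y ^ 2) v, SemiconjBy m y (y * w) := by
    intro m hm
    have h1 : (m * y * m⁻¹) ^ 2 = y ^ 2 := by
      rw [conj_pow, hy2, (hm.mul_right (hv m)).eq, mul_inv_cancel_right]
    obtain ⟨w, hw, e⟩ := sqrt_mem h4 hR hyne (hv y) hv2 hv1 (hvsq y).symm h1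
    exact ⟨w, hw, e ▸ SemiconjBy.conj_self m y⟩
  -- The other values of `w` make `x * y` a nontrivial square equal to `x ^ 2` or `y ^ 2` after
  -- squaring, or make `x` and `y` commute at once.
  have hyx : SemiconjBy y x (x * v) := by
    obtain ⟨w, hw, h⟩ := hconjx y hyz
    have h1 : (x * y) ^ 2 = w * v := by
      rw [h.mul_sq, hy2, hxx, (hW (Commute.refl z) hw).eq, mul_assoc, ← mul_assoc z, hzz, one_mul]
    rcases hw with rfl | rfl | rfl | rfl
    · exact absurd (Commute.symm (show SemiconjBy y x x by simpa using h)) hxy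
    · exact absurd (hmul (commute_of_sq_eq_sq hR hyne (h1.trans hy2.symm))).symm hxy
    · exact h
    · rw [mul_assoc, hvv, mul_one] at h1
      exact absurd (hxmul (commute_of_sq_eq_sq hR hx (h1.trans hz))) hxy
  have hn2 : (x * y) ^ 2 = 1 := by
    rw [hyx.mul_sq, hy2, hxx, ← sq, ← hy2, hs]
  -- No element of the centralizer of `z` inverts `x`, so there `x` has only the conjugates `x` and
  -- `x * v`.
  have hnotz : ∀ m, Commute m z → ¬ SemiconjBy m x (x * z) := by
    intro m hm h
    have hmx := hnc hz1 h
    have hm2 : m ^ 2 = 1 := by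
      by_contra h1
      have h2 : (x * m) ^ 2 = m ^ 2 := by
        rw [h.mul_sq, hxx, hzz, one_mul]
      exact hmx (hmul (commute_of_sq_eq_sq hR h1 h2)).symm
    obtain ⟨w, hw, h'⟩ := hconjy m hm
    have h2 : (y * m) ^ 2 = y ^ 2 * w := by
      rw [h'.mul_sq, hm2, mul_one, ← mul_assoc, ← sq]
    have h3 : SemiconjBy (y * m) x (x * (v * z)) := by
      rw [← mul_assoc]
      exact (hyx.mul_right hyz).mul_left h
    rcases hw with rfl | rfl | rfl | rfl
    · have h5 : Commute y m := Commute.symm (show SemiconjBy m y y by simpa using h')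
      have h6 := involution_mem h4 hR hyne (hv y) hv2 hv1 (hvsq y).symm h5 hm2
      exact hmx (fourSet.commute h6 (hy2 ▸ hxz.mul_right (hv x)) (hv x))
    · rw [← sq, hs] at h2
      have h5 := h3.mul_sq
      rw [h2, mul_one, hxx, hvz.eq, ← mul_assoc z, hzz, one_mul] at h5
      exact hvsq _ h5
    · rw [hy2, mul_assoc, hvv, mul_one] at h2
      exact hnc (hvz.eq ▸ hzvne) h3 (commute_of_sq_eq_sq hR hx (h2.trans hz))
    · rw [← mul_assoc, ← sq, hs, one_mul] at h2
      exact hvsq _ h2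
  have hM : ∀ m, Commute m z → Commute x m ∨ SemiconjBy m x (x * v) := by
    intro m hm
    obtain ⟨w, hw, h⟩ := hconjx m hm
    rcases hw with rfl | rfl | rfl | rfl
    · exact Or.inl (Commute.symm (show SemiconjBy m x x by simpa using h))
    · exact absurd h (hnotz m hm)
    · exact Or.inr h
    · refine absurd ?_ (hnotz (y * m) (hyz.mul_left hm))
      have h5 := (hyx.mul_right (hyz.mul_right (hv y))).mul_left h
      rwa [hvz.symm.eq, ← mul_assoc, mul_assoc x, hvv, mul_one] at h5
  obtain ⟨n, hn⟩ : ∃ n, n = x * y := ⟨_, rfl⟩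
  rw [← hn] at hn2
  have hnz : Commute n z := hn ▸ hxz.mul_left hyz
  have hnn : n * n = 1 := by rw [← sq, hn2]
  have hnx : SemiconjBy n x (x * v) := by
    rw [hn]
    exact SemiconjBy.mul_left ((Commute.refl x).mul_right (hv x)) hyx
  -- the centralizer of `z`
  have hMform : ∀ m, Commute m z →
      ∃ w ∈ fourSet z v, m = w ∨ m = w * n ∨ m = x * w ∨ m = x * (w * n) := by
    intro m hm
    have key : ∀ c, Commute x c → ∃ w ∈ fourSet z v, c = w ∨ c = x * w := fun c hc => by
      rw [hz]
      exact mem_of_commute_of_sq_eq h4 hR hx (hv x) hv2 hv1 hvx hc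
        (sq_eq_of_commute h4 hR hv hv1 hv2 hvsq hx hc)
    rcases hM m hm with h | h
    · obtain ⟨w, hw, e | e⟩ := key m h
      · exact ⟨w, hw, Or.inl e⟩
      · exact ⟨w, hw, Or.inr (Or.inr (Or.inl e))⟩
    · have h5 : Commute x (m * n) := by
        have h6 := (h.mul_right (hv m)).mul_left hnx
        rw [mul_assoc, hvv, mul_one] at h6
        exact Commute.symm h6
      have h7 : m = m * n * n := by rw [mul_assoc, hnn, mul_one]
      obtain ⟨w, hw, e | e⟩ := key _ h5
      · exact ⟨w, hw, Or.inr (Or.inl (by rw [h7, e]))⟩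
      · exact ⟨w, hw, Or.inr (Or.inr (Or.inr (by rw [h7, e, mul_assoc])))⟩
  have hwsq : ∀ {w}, w ∈ fourSet z v → w ^ 2 = 1 := fun hw =>
    fourSet.sq_eq_one hw hz2 hv2 hvz.symm
  have hwnsq : ∀ {w}, w ∈ fourSet z v → (w * n) ^ 2 = 1 := fun hw => by
    rw [(hW hnz hw).symm.mul_pow, hwsq hw, hn2, one_mul]
  have hNform : ∀ m, Commute m z → m ^ 2 = 1 → ∃ w ∈ fourSet z v, m = w ∨ m = w * n := by
    intro m hm hm2
    obtain ⟨w, hw, e | e | e | e⟩ := hMform m hm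
    · exact ⟨w, hw, Or.inl e⟩
    · exact ⟨w, hw, Or.inr e⟩
    · rw [e, (hW hxz hw).mul_pow, hwsq hw, mul_one] at hm2
      exact absurd hm2 hx
    · have h5 : SemiconjBy (w * n) x (x * v) := SemiconjBy.mul_left
        ((hW hxz hw).symm.mul_right (hv w)) hnx
      rw [e, h5.mul_sq, hwnsq hw, mul_one, hxx] at hm2
      exact absurd hm2 hzvne
  have hzw : ∀ {w}, w ∈ fourSet z v → Commute w z := fun hw => (hW (Commute.refl z) hw).symm
  have hNcomm : ∀ a b, Commute a z → a ^ 2 = 1 → Commute b z → b ^ 2 = 1 → Commute a b := by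
    intro a b ha ha2 hb hb2
    obtain ⟨w, hw, ea⟩ := hNform a ha ha2
    obtain ⟨w', hw', eb⟩ := hNform b hb hb2
    have h1 : Commute a n := by
      rcases ea with rfl | rfl
      · exact (hW hnz hw).symm
      · exact (hW hnz hw).symm.mul_left (Commute.refl n)
    rcases eb with rfl | rfl
    · exact hW ha hw'
    · exact (hW ha hw').mul_right h1
  -- N is generated by `z`, `v` and `n`, and the centralizer of `z` is the union of `N` and `x N`.
  let N : Subgroup G :=
    { carrier := {m | Commute m z ∧ m ^ 2 = 1}
      one_mem' := ⟨Commute.one_left z, one_pow 2⟩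
      mul_mem' := fun {a b} ha hb => ⟨ha.1.mul_left hb.1, by
        rw [(hNcomm a b ha.1 ha.2 hb.1 hb.2).mul_pow, ha.2, hb.2, one_mul]⟩
      inv_mem' := fun {a} ha => ⟨ha.1.inv_left, by rw [inv_pow, ha.2, inv_one]⟩ }
  have hNmem : ∀ m, m ∈ N ↔ Commute m z ∧ m ^ 2 = 1 := fun m => Iff.rfl
  have hnorm : N.Normal := by
    refine ⟨fun m hm h => ⟨?_, ?_⟩⟩
    · have h5 : Commute m (h⁻¹ * z * h) := by
        have h6 := SemiconjBy.conj_self h⁻¹ z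
        rw [inv_inv] at h6
        rcases hconj h⁻¹ with h7 | h7
        · rw [SemiconjBy.eq_of h6 h7]
          exact hm.1
        · rw [SemiconjBy.eq_of h6 h7]
          exact hm.1.mul_right (hv m)
      have h6 := (Commute.conj_iff h).mpr h5
      have h7 : h * (h⁻¹ * z * h) * h⁻¹ = z := by group
      rwa [h7] at h6
    · rw [conj_pow, hm.2, mul_one, mul_inv_cancel]
  have hswap : ∀ h, SemiconjBy h z (z * v) → h ^ 2 ∉ fourSet z v := by
    intro h hh hmem
    have hhz : ¬ Commute h z := fun h' => hv1 (mul_eq_left.mp (SemiconjBy.eq_of hh h'))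
    have hself : Commute h (h ^ 2) := (Commute.refl h).pow_right 2
    rcases hmem with e | e | e | e
    · refine hvsq (z * h) ?_
      rw [hh.mul_sq, e, mul_one, ← mul_assoc, hzz, one_mul]
    · exact hhz (e ▸ hself)
    · exact hvsq h e
    · rw [e] at hself
      have h5 := hself.mul_right (hv h)
      rw [mul_assoc, hvv, mul_one] at h5
      exact hhz h5
  have hswap2 : ∀ {a b}, SemiconjBy a z (z * v) → SemiconjBy b z (z * v) → Commute (a * b) z := by
    intro a b ha hb
    have h5 := (ha.mul_right (hv a)).mul_left hb
    rwa [mul_assoc, hvv, mul_one] at h5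
  have hg2z : Commute (g ^ 2) z := sq g ▸ hswap2 hg hg
  -- If `g ^ 2 = w * n`, then `(x * g) ^ 2 = w`, although `x * g` also swaps `z` and `z * v`. So `g
  -- ^ 2` lies in `x N`, and powers of `g` reach every coset of `N`.
  have hg2 : g ^ 2 ∉ N := by
    intro hmem
    obtain ⟨w, hw, e | e⟩ := hNform _ hg2z hmem.2
    · exact hswap g hg (e ▸ hw)
    · have h5 : SemiconjBy (x * g) z (z * v) :=
        SemiconjBy.mul_left (hxz.mul_right (hv x)) hg
      refine hswap _ h5 ?_
      rw [hgxy.mul_sq, e, ← hn, ← mul_assoc, (hW hnz hw).eq, mul_assoc, hnn, mul_one]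
      exact hw
  have hMN : ∀ b, Commute b z → b ∈ N ∨ x⁻¹ * b ∈ N := by
    intro b hb
    obtain ⟨w, hw, e | e | e | e⟩ := hMform b hb
    · exact Or.inl (e ▸ ⟨hzw hw, hwsq hw⟩)
    · exact Or.inl (e ▸ ⟨(hzw hw).mul_left hnz, hwnsq hw⟩)
    · refine Or.inr ?_
      rw [e, inv_mul_cancel_left]
      exact ⟨hzw hw, hwsq hw⟩
    · refine Or.inr ?_
      rw [e, inv_mul_cancel_left]
      exact ⟨(hzw hw).mul_left hnz, hwnsq hw⟩
  have hxg2 : x⁻¹ * g ^ 2 ∈ N := (hMN _ hg2z).resolve_left hg2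
  have hcover : ∀ b, Commute b z → ∃ k : ℤ, b * g ^ k ∈ N := by
    intro b hb
    rcases hMN b hb with h | h
    · exact ⟨0, by simpa using h⟩
    · refine ⟨-2, ?_⟩
      have h5 := hnorm.conj_mem _ (N.mul_mem h (N.inv_mem hxg2)) x
      have h6 : x * (x⁻¹ * b * (x⁻¹ * g ^ 2)⁻¹) * x⁻¹ = b * g ^ (-2 : ℤ) := by group
      rwa [h6] at h5
  refine ⟨N, g, hnorm, fun a ha b hb => hNcomm a b ha.1 ha.2 hb.1 hb.2, fun b => ?_⟩
  rcases hconj b with h | h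
  · exact hcover b h
  · obtain ⟨k, hk⟩ := hcover (b * g) (hswap2 h hg)
    exact ⟨1 + k, by rwa [zpow_add, zpow_one, ← mul_assoc]⟩

/-- Lift a nontrivial central element of `G ⧸ ⟨v⟩` to `q`. Its conjugates are among `q` and `q * v`,
which have the same square; so if `q ^ 2 ≠ 1`, this square is central and replaces `q`. -/
theorem exists_involution_central_mod [Finite G] (h2 : IsPGroup 2 G)
    (hna : ¬ ∀ a b : G, Commute a b) (h4 : ∀ g : G, g ^ 4 = 1) {v : G}
    (hv : ∀ g : G, Commute g v) (hv2 : v ^ 2 = 1) (hvsq : ∀ g : G, g ^ 2 ≠ v) :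
    ∃ z : G, z ^ 2 = 1 ∧ z ≠ 1 ∧ z ≠ v ∧ ∀ g, Commute g z ∨ SemiconjBy g z (z * v) := by
  have hmem : ∀ a, a ∈ Subgroup.zpowers v → a = 1 ∨ a = v := by
    rintro _ ⟨k, rfl⟩
    rcases Int.even_or_odd' k with ⟨m, rfl | rfl⟩
    · left
      simp [zpow_mul, hv2]
    · right
      simp [zpow_add, zpow_mul, hv2]
  have hnorm : (Subgroup.zpowers v).Normal := ⟨fun a ha g => by
    have : Commute g a := by
      rcases hmem a ha with rfl | rfl
      · exact Commute.one_right g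
      · exact hv g
    rwa [this.eq, mul_inv_cancel_right]⟩
  have hnontriv : Nontrivial (G ⧸ Subgroup.zpowers v) := by
    by_contra hsub
    rw [not_nontrivial_iff_subsingleton] at hsub
    refine hna fun a b => ?_
    have hb : b ∈ Subgroup.zpowers v :=
      (QuotientGroup.eq_one_iff b).mp (Subsingleton.elim _ _)
    rcases hmem b hb with rfl | rfl
    · exact Commute.one_right a
    · exact hv a
  have : Nontrivial (Subgroup.center (G ⧸ Subgroup.zpowers v)) :=
    (h2.to_quotient _).center_nontrivial
  obtain ⟨⟨q', hq'⟩, hq1⟩ := exists_ne (1 : Subgroup.center (G ⧸ Subgroup.zpowers v))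
  obtain ⟨q, rfl⟩ := QuotientGroup.mk_surjective q'
  have hqv : q ∉ Subgroup.zpowers v := fun h =>
    hq1 (Subtype.ext ((QuotientGroup.eq_one_iff q).mpr h))
  have hqconj : ∀ g, Commute g q ∨ SemiconjBy g q (q * v) := by
    intro g
    have h1 := Subgroup.mem_center_iff.mp hq' g
    have h3 : (q * g)⁻¹ * (g * q) ∈ Subgroup.zpowers v := QuotientGroup.eq.mp h1.symm
    rcases hmem _ h3 with h | h
    · exact Or.inl (inv_mul_eq_one.mp h).symm
    · refine Or.inr ?_
      rw [inv_mul_eq_iff_eq_mul] at h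
      rw [SemiconjBy, h, mul_assoc, (hv g).eq, ← mul_assoc]
  by_cases hq2 : q ^ 2 = 1
  · exact ⟨q, hq2, fun h => hqv (h ▸ one_mem _), fun h => hqv (h ▸ Subgroup.mem_zpowers v), hqconj⟩
  · refine ⟨q ^ 2, sq_sq_eq_one h4 q, hq2, hvsq q, fun g => Or.inl ?_⟩
    rcases hqconj g with h | h
    · exact h.pow_right 2
    · have h5 := h.pow_right 2
      rwa [(hv q).mul_pow, hv2, mul_one] at h5

theorem cocyclic_of_no_central_square [Finite G] (h2 : IsPGroup 2 G)
    (hna : ¬ ∀ a b : G, Commute a b) (h4 : ∀ g : G, g ^ 4 = 1) (hR : FewSquareRoots G)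
    (hns : ∀ x : G, x ^ 2 ≠ 1 → ¬ ∀ g : G, Commute g (x ^ 2)) :
    HasAbelianNormalCocyclic G := by
  have hnt : Nontrivial G := by
    by_contra h
    rw [not_nontrivial_iff_subsingleton] at h
    exact hna fun a b => Subsingleton.elim _ _
  have hcomm2 : ∀ a b : G, a ^ 2 = 1 → b ^ 2 = 1 → (a * b) ^ 2 = 1 → Commute a b := by
    intro a b ha hb hab
    have e : ∀ {c : G}, c ^ 2 = 1 → c⁻¹ = c := fun h =>
      inv_eq_of_mul_eq_one_left (by rw [← sq, h])
    have := e hab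
    rw [mul_inv_rev, e ha, e hb] at this
    exact this.symm
  have : Nontrivial (Subgroup.center G) := h2.center_nontrivial
  obtain ⟨⟨v, hvc⟩, hv1⟩ := exists_ne (1 : Subgroup.center G)
  replace hv1 : v ≠ 1 := fun h => hv1 (Subtype.ext h)
  have hv : ∀ g : G, Commute g v := fun g => Subgroup.mem_center_iff.mp hvc g
  have hv2 : v ^ 2 = 1 := by
    by_contra h
    exact hns v h fun g => (hv g).pow_right 2
  have hvsq : ∀ g : G, g ^ 2 ≠ v := by
    rintro g rfl
    exact hns g hv1 hv
  obtain ⟨z, hz2, hz1, hzv, hconj⟩ := exists_involution_central_mod h2 hna h4 hv hv2 hvsq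
  have hzx : ∀ x, x ^ 2 ≠ 1 → Commute x z → x ^ 2 = z ∨ x ^ 2 = z * v := by
    intro x hx hxz
    rcases involution_mem h4 hR hx (hv x) hv2 hv1 (hvsq x).symm hxz hz2 with e | e | e | e
    · exact absurd e hz1
    · exact Or.inl e.symm
    · exact absurd e hzv
    · refine Or.inr ?_
      rw [e, mul_assoc, ← sq, hv2, mul_one]
  obtain ⟨x₀, hx₀⟩ : ∃ x : G, x ^ 2 ≠ 1 := by
    by_contra! h
    exact hna fun a b => hcomm2 a b (h a) (h b) (h _)
  -- Were `z` central, the square of `x₀`, being `z` or `z * v`, would be central too.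
  obtain ⟨g, hgz⟩ : ∃ g, ¬ Commute g z := by
    by_contra! h
    rcases hzx x₀ hx₀ (h x₀) with e | e
    · exact hns x₀ hx₀ fun g => e ▸ h g
    · exact hns x₀ hx₀ fun g => e ▸ (h g).mul_right (hv g)
  have hg := (hconj g).resolve_left hgz
  by_cases hM : ∃ x, Commute x z ∧ x ^ 2 ≠ 1
  · obtain ⟨x, hxz, hx⟩ := hM
    rcases hzx x hx hxz with e | e
    · exact cocyclic_of_almost_central_square h4 hR hv hv1 hv2 hvsq hx (e ▸ hconj) (e ▸ hg)
    · refine cocyclic_of_almost_central_square (g := g) h4 hR hv hv1 hv2 hvsq hx ?_ ?_ <;> rw [e]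
      · exact fun h => (hconj h).imp (fun h' => h'.mul_right (hv h)) fun h' => h'.mul_right (hv h)
      · exact hg.mul_right (hv g)
  -- Here the centralizer of `z` has exponent 2, hence is abelian, and its index is 2.
  · push Not at hM
    refine hasAbelianNormalCocyclic_of_two_cosets (Subgroup.centralizer {z}) g ?_ fun b => ?_
    · intro a ha b hb
      rw [mem_centralizer_singleton'] at ha hb
      exact hcomm2 a b (hM a ha.symm) (hM b hb.symm) (hM _ (ha.symm.mul_left hb.symm))
    · rw [mem_centralizer_singleton', mem_centralizer_singleton']
      refine (hconj b).imp Commute.symm fun h => ?_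
      have h5 := (h.mul_right (hv b)).mul_left hg
      rw [mul_assoc, ← sq v, hv2, mul_one] at h5
      exact Commute.symm h5

end

theorem mainTheorem10 {G : Type*} [Group G] [Finite G]
    (h2 : IsPGroup 2 G) (hna : ¬ IsMulCommutative G) (hexp : Monoid.exponent G = 4)
    (hclaw : IsClawFree (reducedPowerGraph G)) :
    ∃ (N : Subgroup G) (x : G),
      N.Normal ∧ IsMulCommutative N ∧
      (N : Set G) * (Subgroup.zpowers x : Set G) = Set.univ ∧
      orderOf x ≤ 4 ∧
      ((∀ n ∈ N, n ^ 2 = 1) ∨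
        ∃ f : N →* Multiplicative (ZMod 4) × Multiplicative (ZMod 4),
          Function.Injective f) := by
  have h4 : ∀ g : G, g ^ 4 = 1 := fun g => hexp ▸ Monoid.pow_exponent_eq_one g
  have hR := fewSquareRoots_of_isClawFree h4 hclaw
  refine HasAbelianNormalCocyclic.conclusion h4 hR ?_
  by_cases hz : ∃ x : G, x ^ 2 ≠ 1 ∧ ∀ g : G, Commute g (x ^ 2)
  · obtain ⟨x, hx, hz⟩ := hz
    exact cocyclic_of_central_square h4 hR hx hz
  · push Not at hz
    refine cocyclic_of_no_central_square h2 (fun h => hna ⟨⟨h⟩⟩) h4 hR fun x hx h => ?_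
    obtain ⟨g, hg⟩ := hz x hx
    exact hg (h g)
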